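/- **Proposition (approximation of $\sqrt{1-e^{-t}}$ by attention-only Transformers).** *Model class.* For $\lambda>0$ let $\mathrm{Softmax}_\lambda(u)_i=e^{\lambda u_i}/\sum_j e^{\lambda u_j}$, applied column-wise to matrices. An $H$-head attention layer is a map $Z\mapsto\sum_{h=1}^H W_V^{(h)}Z\,\mathrm{Softmax}_\lambda\big((W_K^{(h)}Z)^\top W_Q^{(h)}Z\big)$ with $W_K^{(h)},W_Q^{(h)}\in\mathbb R^{d_h\times d_{\rm in}}$, $W_V^{(h)}\in\mathbb R^{d_{\rm out}\times d_{\rm in}}$; put $W_{KQ}^{(h)}=(W_K^{(h)})^\top W_Q^{(h)}$. For $X\in\mathbb R^{d\times n}$ let $$P(X)=\begin{bmatrix}X&0\\ I_n&0\\ 0&1\end{bmatrix}\in\mathbb R^{(d+n+1)\times(n+1)},$$ and let $T$ delete the last column. The class $\mathcal T(H,W,K,C_{KQ},C_V)$, $C_{KQ},C_V>0$, with inverse temperature $\lambda>0$, consists of all maps $T\circ\mathrm{Attn}^{(K)}\circ\cdots\circ\mathrm{Attn}^{(1)}\circ P$ in which each $\mathrm{Attn}^{(j)}:\mathbb R^{d_j\times(n+1)}\to\mathbb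 R^{d_{j+1}\times(n+1)}$ ($d_1=d+n+1$) is an $H$-head layer with this $\lambda$, $W$ is the maximum of all token dimensions $d_1,\dots,d_{K+1}$ and all head dimensions, and $C_V$, $C_{KQ}$ are the maxima over all layers and heads of $\|W_V\|_F$ and $\|W_{KQ}\|_F$. A real number $t$ is regarded as an input with $d=n=1$, and the output dimension is $1$. *Statement.* There are a constant $C>0$ and a real polynomial $p$ such that for every $\epsilon\in(0,1)$ and every $C_X>\epsilon$ there is $f_\sigma\in\mathcal T(H,W,K,C_{KQ},C_V)$, for some $H,W,K,C_{KQ},C_V$ and some inverse temperature $\lambda>0$, with $$\big|f_\sigma(t)-\sqrt{1-e^{-t}}\big|\le\epsilon\qquad\text{for all }\epsilon\le t\le C_X,$$ and such that, writing $\delta=1/\epsilon$, if moreover $C_X\ge1$ and $\epsilon\le\tfrac12$, then the parameters of $f_\sigma$ satisfy $$H\le C\ln^3\delta,\qquad W\le C\ln^3\delta,\qquad K\le C\ln^2\delta,$$ $$C_V\le \exp(C\ln^2\delta)\cdot C\sqrt{\ln^3\delta},\qquad C_{KQ}\le C\sqrt{\ln^2\delta\,(\ln^2\delta+\ln C_X)},$$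 $$\lambda\le \exp(C\ln^4\delta)\cdot C\,(\ln\delta)^{p(\ln\delta)}\,(1+\ln C_X).$$ -/

import Mathlib

noncomputable section

namespace AttnOnly

open scoped Matrix

/-- Softmax with inverse temperature `lam` of a vector. -/
def softmax (lam : ℝ) {m : ℕ} (u : Fin m → ℝ) : Fin m → ℝ :=
  fun i => Real.exp (lam * u i) / ∑ j, Real.exp (lam * u j)

/-- Column-wise softmax of a matrix. -/
def colSoftmax (lam : ℝ) {m n : ℕ} (X : Matrix (Fin m) (Fin n) ℝ) :
    Matrix (Fin m) (Fin n) ℝ :=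
  Matrix.of fun i k => softmax lam (fun r => X r k) i

/-- The weights of one attention head; `dim` is the head dimension, which may differ from head
to head. -/
structure AttnHead (dIn dOut : ℕ) where
  dim : ℕ
  WK : Matrix (Fin dim) (Fin dIn) ℝ
  WQ : Matrix (Fin dim) (Fin dIn) ℝ
  WV : Matrix (Fin dOut) (Fin dIn) ℝ

/-- The product of the transposed key matrix with the query matrix. -/
def AttnHead.WKQ {dIn dOut : ℕ} (h : AttnHead dIn dOut) : Matrix (Fin dIn) (Fin dIn) ℝ :=
  h.WKᵀ * h.WQ

/-- The weights of a self-attention layer with `H` heads. -/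
abbrev AttnLayer (H dIn dOut : ℕ) : Type := Fin H → AttnHead dIn dOut

/-- The map `Z ↦ ∑ h, W_V Z Softmax((W_K Z)ᵀ (W_Q Z))` of a multi-head self-attention layer
acting on sequences of `m` tokens. -/
def attn (lam : ℝ) {H dIn dOut m : ℕ} (L : AttnLayer H dIn dOut)
    (Z : Matrix (Fin dIn) (Fin m) ℝ) : Matrix (Fin dOut) (Fin m) ℝ :=
  ∑ h, (L h).WV * Z * colSoftmax lam (((L h).WK * Z)ᵀ * ((L h).WQ * Z))

/-- `AttnStack H K dIn dOut`: the weights of `K` composable attention layers with `H` heads each,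
from token dimension `dIn` to token dimension `dOut`. In `cons L S` the layer `L` is applied
first. -/
inductive AttnStack (H : ℕ) : ℕ → ℕ → ℕ → Type
  | nil (d : ℕ) : AttnStack H 0 d d
  | cons {K d₁ d₂ d₃ : ℕ} (L : AttnLayer H d₁ d₂) (S : AttnStack H K d₂ d₃) :
      AttnStack H (K + 1) d₁ d₃

namespace AttnStack

/-- The composition of the layers. -/
def eval (lam : ℝ) {H m : ℕ} : {K dIn dOut : ℕ} → AttnStack H K dIn dOut →
    Matrix (Fin dIn) (Fin m) ℝ → Matrix (Fin dOut) (Fin m) ℝ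
  | _, _, _, nil _, Z => Z
  | _, _, _, cons L S, Z => S.eval lam (attn lam L Z)

/-- All token dimensions (input, intermediate, output) and all head dimensions. -/
def dims {H : ℕ} : {K dIn dOut : ℕ} → AttnStack H K dIn dOut → Set ℕ
  | _, _, _, nil d => {d}
  | _, dIn, _, cons L S => {dIn} ∪ Set.range (fun h => (L h).dim) ∪ S.dims

open scoped Matrix.Norms.Frobenius in
/-- The Frobenius norms of all value matrices. -/
def normsV {H : ℕ} : {K dIn dOut : ℕ} → AttnStack H K dIn dOut → Set ℝ
  | _, _, _, nil _ => ∅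
  | _, _, _, cons L S => Set.range (fun h => ‖(L h).WV‖) ∪ S.normsV

open scoped Matrix.Norms.Frobenius in
/-- The Frobenius norms of all key-query products. -/
def normsKQ {H : ℕ} : {K dIn dOut : ℕ} → AttnStack H K dIn dOut → Set ℝ
  | _, _, _, nil _ => ∅
  | _, _, _, cons L S => Set.range (fun h => ‖(L h).WKQ‖) ∪ S.normsKQ

end AttnStack

/-- The preprocessing layer: it pads one zero token and appends one-hot positional encodings,
`X ↦ [X, 0; I_n, 0; 0, 1]`. -/
def preprocess {d n : ℕ} (X : Matrix (Fin d) (Fin n) ℝ) :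
    Matrix (Fin (d + n + 1)) (Fin (n + 1)) ℝ :=
  Matrix.of fun i j =>
    Fin.lastCases (motive := fun _ => ℝ)
      (Fin.append (Fin.append (0 : Fin d → ℝ) (0 : Fin n → ℝ)) (1 : Fin 1 → ℝ) i)
      (fun k => Fin.append (Fin.append (fun r => X r k) (Pi.single k 1)) (0 : Fin 1 → ℝ) i) j

/-- The truncation layer: it deletes the last token. -/
def truncate {d n : ℕ} (Z : Matrix (Fin d) (Fin (n + 1)) ℝ) : Matrix (Fin d) (Fin n) ℝ :=
  Matrix.of fun i j => Z i j.castSucc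

/-- The class of attention-only Transformers `T ∘ Attn_K ∘ ⋯ ∘ Attn_1 ∘ P` with `H` heads per
layer, width `W`, depth `K`, inverse temperature `lam`, and maximal Frobenius norms `CKQ` of the
key-query products and `CV` of the value matrices. -/
def TransformerClass (d n dOut H W K : ℕ) (lam CKQ CV : ℝ) :
    Set (Matrix (Fin d) (Fin n) ℝ → Matrix (Fin dOut) (Fin n) ℝ) :=
  {τ | 0 < lam ∧ 0 < CKQ ∧ 0 < CV ∧
    ∃ S : AttnStack H K (d + n + 1) dOut,
      IsGreatest S.dims W ∧ IsGreatest S.normsKQ CKQ ∧ IsGreatest S.normsV CV ∧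
      ∀ X, τ X = truncate (S.eval lam (preprocess X))}

end AttnOnly

end

/-!
For `|r| ≤ 1` the binomial series of `(1 - y) ^ r` has coefficients bounded by `1`, so its
truncation at degree `2 ^ O(k)` is accurate to `2 ^ (-k)` as long as `1 - y ≥ 2 ^ (-k)`.
Only `O(k ^ 2)` monomials are needed: the exponents below `2 ^ A` lie within a factor `3 / 2`
above one of `O(A)` base exponents `N`, and in `y ^ (N + j)` with `2 * j ≤ N` the factor `y ^ j`
may be replaced by its Taylor polynomial of order `m` at `1` with an error of `2 ^ (-m)`, because
`y ^ N` is small away from `y = 1`. Monomials with different `j` and the same `N` thus collapse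
to `m` monomials.

At `y = exp (-t)` the monomial `y ^ j` is approximately `s * sigmoid (-(j * t + log s))` for
large `s`, and such a sigmoid is the softmax of the logits of two tokens. Hence one attention
layer with one head per monomial suffices, and the approximation is uniform in `t ≥ ε`.
-/

open Finset Polynomial

section BinomialExpansion

theorem pow_mul_choose_le_choose_mul (a j m : ℕ) : a ^ m * j.choose m ≤ (a * j).choose m := by
  rcases a.eq_zero_or_pos with rfl | ha
  · cases m <;> simp
  induction m with
  | zero => simp
  | succ m ih =>
    refine Nat.le_of_mul_le_mul_right (c := m + 1) ?_ m.succ_pos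
    have hsub : a * (j - m) ≤ a * j - m := by
      rw [Nat.mul_sub]
      exact Nat.sub_le_sub_left (Nat.le_mul_of_pos_left m ha) _
    calc a ^ (m + 1) * j.choose (m + 1) * (m + 1)
        = a ^ (m + 1) * (j.choose m * (j - m)) := by rw [mul_assoc, Nat.choose_succ_right_eq]
      _ = a ^ m * j.choose m * (a * (j - m)) := by ring
      _ ≤ (a * j).choose m * (a * j - m) := Nat.mul_le_mul ih hsub
      _ = (a * j).choose (m + 1) * (m + 1) := (Nat.choose_succ_right_eq _ _).symm

theorem choose_mul_pow_mul_pow_le_add_pow {R : Type*} [CommSemiring R] [PartialOrder R]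
    [IsOrderedRing R] (m n : ℕ) {x y : R} (hx : 0 ≤ x) (hy : 0 ≤ y) :
    ((n + m).choose m : R) * (x ^ m * y ^ n) ≤ (x + y) ^ (n + m) := by
  have hterm := single_le_sum
    (f := fun i ↦ x ^ i * y ^ (n + m - i) * ((n + m).choose i : R))
    (fun i _ ↦ mul_nonneg (mul_nonneg (pow_nonneg hx _) (pow_nonneg hy _)) (Nat.cast_nonneg _))
    (mem_range.2 (show m < n + m + 1 by lia))
  rwa [← add_pow, Nat.add_sub_cancel, mul_comm] at hterm

/-- The Taylor polynomial of order `m` (hence of degree less than `m`) of `X ^ j` at `1`. -/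
noncomputable def powTaylor (R : Type*) [CommRing R] (m j : ℕ) : R[X] :=
  ∑ i ∈ range m, C (j.choose i : R) * (X - 1) ^ i

section CommRing

variable {R : Type*} [CommRing R]

theorem powTaylor_succ_succ (m j : ℕ) :
    powTaylor R (m + 1) (j + 1) = powTaylor R (m + 1) j + (X - 1) * powTaylor R m j := by
  simp only [powTaylor, sum_range_succ' _ m, mul_sum, Nat.choose_succ_succ, Nat.cast_add,
    C_add, add_mul, sum_add_distrib, Nat.choose_zero_right]
  have hshift : ∀ i, C (j.choose i : R) * (X - 1) ^ (i + 1) =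
      (X - 1) * (C (j.choose i : R) * (X - 1) ^ i) := fun i ↦ by ring
  simp only [hshift]
  ring

theorem coeff_powTaylor (m j l : ℕ) :
    (powTaylor R m j).coeff l =
      ∑ i ∈ range m, (j.choose i : R) * ((-1) ^ (i - l) * (i.choose l : R)) := by
  simp only [powTaylor, finsetSum_coeff, coeff_C_mul, sub_eq_add_neg, ← C_1, ← C_neg,
    coeff_X_add_C_pow]

theorem coeff_powTaylor_eq_zero {m j l : ℕ} (hl : m ≤ l) : (powTaylor R m j).coeff l = 0 := by
  rw [coeff_powTaylor]
  refine sum_eq_zero fun i hi ↦ ?_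
  rw [Nat.choose_eq_zero_of_lt ((mem_range.1 hi).trans_le hl)]
  simp

end CommRing

section Ordered

variable {R : Type*} [CommRing R] [LinearOrder R] [IsStrictOrderedRing R]

theorem abs_coeff_powTaylor_le (m j l : ℕ) :
    |(powTaylor R m j).coeff l| ≤ (2 * (j + 1)) ^ m := by
  have hterm : ∀ i, |(j.choose i : R) * ((-1) ^ (i - l) * (i.choose l : R))| ≤
      (((2 * (j + 1)) ^ i : ℕ) : R) := fun i ↦ by
    simp only [abs_mul, abs_pow, abs_neg, abs_one, one_pow, one_mul, Nat.abs_cast]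
    rw [← Nat.cast_mul, Nat.cast_le, mul_pow, mul_comm]
    exact Nat.mul_le_mul (Nat.choose_le_two_pow i l)
      ((Nat.choose_le_pow j i).trans (Nat.pow_le_pow_left j.le_succ i))
  rw [coeff_powTaylor]
  calc |∑ i ∈ range m, (j.choose i : R) * ((-1) ^ (i - l) * (i.choose l : R))|
      ≤ ∑ i ∈ range m, (((2 * (j + 1)) ^ i : ℕ) : R) :=
        (abs_sum_le_sum_abs _ _).trans (sum_le_sum fun i _ ↦ hterm i)
    _ ≤ (((2 * (j + 1)) ^ m : ℕ) : R) := by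
        rw [← Nat.cast_sum, Nat.cast_le]
        exact (Nat.geomSum_lt (by lia) fun i hi ↦ mem_range.1 hi).le
    _ = (2 * (j + 1)) ^ m := by push_cast; ring

theorem abs_pow_sub_eval_powTaylor_le (m j : ℕ) {y : R} (h0 : 0 ≤ y) (h1 : y ≤ 1) :
    |y ^ j - (powTaylor R m j).eval y| ≤ j.choose m * (1 - y) ^ m := by
  induction j generalizing m with
  | zero =>
    cases m with
    | zero => simp [powTaylor]
    | succ m => simp [powTaylor, sum_range_succ']
  | succ j ih =>
    cases m with
    | zero => simpa [powTaylor, abs_of_nonneg h0] using pow_le_one₀ (n := j + 1) h0 h1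
    | succ m =>
      have hremainder : y ^ (j + 1) - (powTaylor R (m + 1) (j + 1)).eval y =
          (y ^ j - (powTaylor R (m + 1) j).eval y) -
            (1 - y) * (y ^ j - (powTaylor R m j).eval y) := by
        rw [powTaylor_succ_succ]
        simp only [eval_add, eval_mul, eval_sub, eval_X, eval_one]
        ring
      rw [hremainder]
      calc |(y ^ j - (powTaylor R (m + 1) j).eval y) -
            (1 - y) * (y ^ j - (powTaylor R m j).eval y)|
          ≤ |y ^ j - (powTaylor R (m + 1) j).eval y| +
            (1 - y) * |y ^ j - (powTaylor R m j).eval y| := by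
            refine (abs_sub _ _).trans_eq ?_
            rw [abs_mul, abs_of_nonneg (sub_nonneg.2 h1)]
        _ ≤ j.choose (m + 1) * (1 - y) ^ (m + 1) + (1 - y) * (j.choose m * (1 - y) ^ m) :=
            add_le_add (ih _) (mul_le_mul_of_nonneg_left (ih m) (sub_nonneg.2 h1))
        _ = (j + 1).choose (m + 1) * (1 - y) ^ (m + 1) := by
            rw [Nat.choose_succ_succ]
            push_cast
            ring

end Ordered

-- `2 ^ m * C(j, m) ≤ C(2 j, m) ≤ C(N + m, m)` beats the remainder `C(j, m) (1 - y) ^ m`,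
-- because the Bernstein polynomial `C(N + m, m) (1 - y) ^ m y ^ N` is at most `1`.
theorem abs_pow_add_sub_pow_mul_eval_powTaylor_le {R : Type*} [Field R] [LinearOrder R]
    [IsStrictOrderedRing R] {N j : ℕ} (m : ℕ) (hj : 2 * j ≤ N) {y : R} (h0 : 0 ≤ y)
    (h1 : y ≤ 1) :
    |y ^ (N + j) - y ^ N * (powTaylor R m j).eval y| ≤ (1 / 2) ^ m := by
  have hchoose : (2 : R) ^ m * j.choose m ≤ (N + m).choose m := mod_cast
    (pow_mul_choose_le_choose_mul 2 j m).trans (Nat.choose_le_choose m (by lia))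
  have hz : 0 ≤ 1 - y := sub_nonneg.2 h1
  rw [pow_add, ← mul_sub, abs_mul, abs_of_nonneg (pow_nonneg h0 N), one_div_pow,
    le_div_iff₀' (by positivity)]
  calc 2 ^ m * (y ^ N * |y ^ j - (powTaylor R m j).eval y|)
      ≤ 2 ^ m * (y ^ N * (j.choose m * (1 - y) ^ m)) := by
        gcongr
        exact abs_pow_sub_eval_powTaylor_le m j h0 h1
    _ = 2 ^ m * j.choose m * ((1 - y) ^ m * y ^ N) := by ring
    _ ≤ (N + m).choose m * ((1 - y) ^ m * y ^ N) := by gcongr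
    _ ≤ (1 - y + y) ^ (N + m) := choose_mul_pow_mul_pow_le_add_pow m N hz h0
    _ = 1 := by rw [sub_add_cancel, one_pow]

end BinomialExpansion

section Sparsify

theorem exists_card_le_forall_lt_two_pow_exists_two_mul_sub_le (A : ℕ) :
    ∃ B : Finset ℕ, #B ≤ 2 * A + 1 ∧ ∀ k < 2 ^ A, ∃ N ∈ B, N ≤ k ∧ 2 * (k - N) ≤ N := by
  induction A with
  | zero => exact ⟨{0}, by simp, fun k hk ↦ ⟨0, by simp, by simp, by lia⟩⟩
  | succ A ih =>
    obtain ⟨B, hB, hbase⟩ := ih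
    refine ⟨insert (2 ^ A) (insert (3 * 2 ^ A / 2) B), ?_, fun k hk ↦ ?_⟩
    · have := card_insert_le (2 ^ A) (insert (3 * 2 ^ A / 2) B)
      have := card_insert_le (3 * 2 ^ A / 2) B
      lia
    · rw [pow_succ] at hk
      rcases lt_or_ge k (2 ^ A) with hlt | hge
      · obtain ⟨N, hN, hNk⟩ := hbase k hlt
        exact ⟨N, by simp [hN], hNk⟩
      · rcases lt_or_ge k (3 * 2 ^ A / 2) with hlt' | hge'
        · exact ⟨2 ^ A, by simp, by lia, by lia⟩
        · exact ⟨3 * 2 ^ A / 2, by simp, by lia, by lia⟩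

/-- The compression of a polynomial `p` along a choice of base exponents: each monomial
`X ^ k = X ^ base k * X ^ (k - base k)` of `p` has its second factor replaced by the Taylor
polynomial of order `m` at `1`. -/
noncomputable def sparsify {R : Type*} [CommRing R] (base : ℕ → ℕ) (m : ℕ) (p : R[X]) : R[X] :=
  ∑ k ∈ p.support, C (p.coeff k) * (X ^ base k * powTaylor R m (k - base k))

section CommRing

variable {R : Type*} [CommRing R] {base : ℕ → ℕ} {m : ℕ} {p : R[X]}

theorem coeff_sparsify (l : ℕ) :
    (sparsify base m p).coeff l = ∑ k ∈ p.support, p.coeff k *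
      if base k ≤ l then (powTaylor R m (k - base k)).coeff (l - base k) else 0 := by
  simp only [sparsify, finsetSum_coeff, coeff_C_mul, coeff_X_pow_mul']

theorem exists_of_mem_support_sparsify {l : ℕ} (hl : l ∈ (sparsify base m p).support) :
    ∃ k ∈ p.support, ∃ i < m, base k + i = l := by
  rw [mem_support_iff, coeff_sparsify] at hl
  obtain ⟨k, hk, hne⟩ := exists_ne_zero_of_sum_ne_zero hl
  have hle : base k ≤ l := by
    by_contra hlt
    simp [hlt] at hne
  refine ⟨k, hk, l - base k, ?_, Nat.add_sub_cancel' hle⟩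
  by_contra! hge
  simp [hle, coeff_powTaylor_eq_zero hge] at hne

theorem card_support_sparsify_le {B : Finset ℕ} (hB : ∀ k ∈ p.support, base k ∈ B) :
    #(sparsify base m p).support ≤ #B * m := by
  have hsub : (sparsify base m p).support ⊆ (B ×ˢ range m).image fun q ↦ q.1 + q.2 := by
    intro l hl
    obtain ⟨k, hk, i, hi, rfl⟩ := exists_of_mem_support_sparsify hl
    exact mem_image_of_mem _ (mk_mem_product (hB k hk) (mem_range.2 hi))
  simpa using (card_le_card hsub).trans card_image_le

theorem natDegree_sparsify_le (hbase : ∀ k ∈ p.support, base k ≤ k) :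
    (sparsify base m p).natDegree ≤ p.natDegree + m := by
  refine natDegree_le_iff_coeff_eq_zero.2 fun l hl ↦ notMem_support_iff.1 fun hmem ↦ ?_
  obtain ⟨k, hk, i, hi, rfl⟩ := exists_of_mem_support_sparsify hmem
  have := hbase k hk
  have := le_natDegree_of_mem_supp k hk
  lia

end CommRing

theorem abs_coeff_sparsify_le {R : Type*} [CommRing R] [LinearOrder R] [IsStrictOrderedRing R]
    {p : R[X]} (hp : ∀ k, |p.coeff k| ≤ 1) (base : ℕ → ℕ) (m l : ℕ) :
    |(sparsify base m p).coeff l| ≤ #p.support * (2 * (p.natDegree + 1)) ^ m := by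
  have hterm : ∀ k ∈ p.support, |p.coeff k *
      if base k ≤ l then (powTaylor R m (k - base k)).coeff (l - base k) else 0| ≤
        (2 * (p.natDegree + 1)) ^ m := fun k hk ↦ by
    rw [abs_mul]
    refine (mul_le_of_le_one_left (abs_nonneg _) (hp k)).trans ?_
    split_ifs
    · refine (abs_coeff_powTaylor_le _ _ _).trans ?_
      have hk' : ((k - base k : ℕ) : R) ≤ p.natDegree :=
        Nat.cast_le.2 ((Nat.sub_le _ _).trans (le_natDegree_of_mem_supp k hk))
      gcongr
    · rw [abs_zero]
      positivity
  rw [coeff_sparsify, ← nsmul_eq_mul]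
  exact (abs_sum_le_sum_abs _ _).trans (sum_le_card_nsmul _ _ _ hterm)

section Field

variable {R : Type*} [Field R] [LinearOrder R] [IsStrictOrderedRing R] {p : R[X]}

theorem abs_eval_sub_eval_sparsify_le (hp : ∀ k, |p.coeff k| ≤ 1) {base : ℕ → ℕ}
    (hle : ∀ k ∈ p.support, base k ≤ k) (htwo : ∀ k ∈ p.support, 2 * (k - base k) ≤ base k)
    (m : ℕ) {y : R} (h0 : 0 ≤ y) (h1 : y ≤ 1) :
    |p.eval y - (sparsify base m p).eval y| ≤ #p.support * (1 / 2) ^ m := by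
  have hterm : ∀ k ∈ p.support, |p.coeff k * y ^ k -
      p.coeff k * (y ^ base k * (powTaylor R m (k - base k)).eval y)| ≤ (1 / 2) ^ m :=
    fun k hk ↦ by
      have hpow := abs_pow_add_sub_pow_mul_eval_powTaylor_le m (htwo k hk) h0 h1
      rw [Nat.add_sub_cancel' (hle k hk)] at hpow
      rw [← mul_sub, abs_mul]
      exact (mul_le_of_le_one_left (abs_nonneg _) (hp k)).trans hpow
  rw [eval_eq_sum, sum_def, sparsify, eval_finsetSum, ← sum_sub_distrib, ← nsmul_eq_mul]
  refine (abs_sum_le_sum_abs _ _).trans (sum_le_card_nsmul _ _ _ fun k hk ↦ ?_)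
  simpa only [eval_mul, eval_C, eval_pow, eval_X] using hterm k hk

theorem exists_sparse_approx {A : ℕ} (hdeg : p.natDegree < 2 ^ A)
    (hp : ∀ k, |p.coeff k| ≤ 1) (m : ℕ) :
    ∃ q : R[X], #q.support ≤ (2 * A + 1) * m ∧ q.natDegree < 2 ^ A + m ∧
      (∀ l, |q.coeff l| ≤ 2 ^ A * (2 * 2 ^ A) ^ m) ∧
      ∀ y : R, 0 ≤ y → y ≤ 1 → |p.eval y - q.eval y| ≤ 2 ^ A * (1 / 2) ^ m := by
  obtain ⟨B, hB, hbase⟩ := exists_card_le_forall_lt_two_pow_exists_two_mul_sub_le A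
  choose! base hmem hle htwo using hbase
  have hlt : ∀ k ∈ p.support, k < 2 ^ A := fun k hk ↦
    (le_natDegree_of_mem_supp k hk).trans_lt hdeg
  have hcard : (#p.support : R) ≤ 2 ^ A := mod_cast (card_supp_le_succ_natDegree p).trans hdeg
  have hdeg' : (p.natDegree : R) + 1 ≤ 2 ^ A := mod_cast hdeg
  refine ⟨sparsify base m p, ?_, ?_, fun l ↦ ?_, fun y h0 h1 ↦ ?_⟩
  · exact (card_support_sparsify_le fun k hk ↦ hmem k (hlt k hk)).trans
      (Nat.mul_le_mul_right m hB)
  · exact (natDegree_sparsify_le fun k hk ↦ hle k (hlt k hk)).trans_lt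
      (Nat.add_lt_add_right hdeg m)
  · refine (abs_coeff_sparsify_le hp base m l).trans ?_
    gcongr
  · refine (abs_eval_sub_eval_sparsify_le hp (fun k hk ↦ hle k (hlt k hk))
      (fun k hk ↦ htwo k (hlt k hk)) m h0 h1).trans ?_
    gcongr

end Field

end Sparsify

section BinomialSeries

theorem abs_ringChoose_le_one {r : ℝ} (hr : |r| ≤ 1) (k : ℕ) : |Ring.choose r k| ≤ 1 := by
  induction k with
  | zero => simp
  | succ k ih =>
    have hrec : Ring.choose r (k + 1) * (k + 1) = Ring.choose r k * (r - k) := by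
      simpa [mul_comm] using Ring.choose_smul_choose r k.le_succ
    have hfactor : |r - k| ≤ k + 1 := by
      refine (abs_sub _ _).trans ?_
      rw [Nat.abs_cast]
      linarith
    have hpos : (0 : ℝ) < k + 1 := k.cast_add_one_pos
    refine le_of_mul_le_mul_right ?_ hpos
    calc |Ring.choose r (k + 1)| * (k + 1)
        = |Ring.choose r k| * |r - k| := by
          rw [← abs_mul, ← hrec, abs_mul, abs_of_pos hpos]
      _ ≤ 1 * (k + 1) := mul_le_mul ih hfactor (abs_nonneg _) zero_le_one

theorem hasSum_ringChoose_mul_pow_one_sub_rpow (r : ℝ) {y : ℝ} (hy : |y| < 1) :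
    HasSum (fun k ↦ Ring.choose r k * (-1) ^ k * y ^ k) ((1 - y) ^ r) := by
  have hseries := (Real.one_add_rpow_hasFPowerSeriesOnBall_zero (a := r)).hasSum (y := -y) (by
    rw [← ENNReal.ofReal_one, Metric.eball_ofReal]
    simpa using hy)
  simp only [binomialSeries_apply, zero_add, List.ofFn_const, List.prod_replicate,
    smul_eq_mul] at hseries
  simpa only [mul_assoc, ← mul_pow, neg_one_mul, sub_eq_add_neg] using hseries

/-- The Taylor polynomial of order `M` (hence of degree less than `M`) of `y ↦ (1 - y) ^ r`
at `0`. -/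
noncomputable def oneSubRpowTaylor (r : ℝ) (M : ℕ) : ℝ[X] :=
  ∑ k ∈ range M, C (Ring.choose r k * (-1) ^ k) * X ^ k

theorem coeff_oneSubRpowTaylor (r : ℝ) (M l : ℕ) :
    (oneSubRpowTaylor r M).coeff l = if l < M then Ring.choose r l * (-1) ^ l else 0 := by
  simp only [oneSubRpowTaylor, finsetSum_coeff, coeff_C_mul_X_pow, sum_ite_eq, mem_range]

theorem abs_coeff_oneSubRpowTaylor_le_one {r : ℝ} (hr : |r| ≤ 1) (M l : ℕ) :
    |(oneSubRpowTaylor r M).coeff l| ≤ 1 := by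
  rw [coeff_oneSubRpowTaylor]
  split_ifs
  · simpa [abs_mul] using abs_ringChoose_le_one hr l
  · simp

theorem natDegree_oneSubRpowTaylor_lt (r : ℝ) {M : ℕ} (hM : 0 < M) :
    (oneSubRpowTaylor r M).natDegree < M := by
  refine Nat.lt_of_le_pred hM (natDegree_le_iff_coeff_eq_zero.2 fun l hl ↦ ?_)
  rw [coeff_oneSubRpowTaylor, if_neg (Nat.le_of_pred_lt hl).not_gt]

theorem abs_one_sub_rpow_sub_eval_oneSubRpowTaylor_le {r : ℝ} (hr : |r| ≤ 1) (M : ℕ) {y : ℝ}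
    (h0 : 0 ≤ y) (h1 : y < 1) :
    |(1 - y) ^ r - (oneSubRpowTaylor r M).eval y| ≤ y ^ M / (1 - y) := by
  have htail := (hasSum_nat_add_iff' M).2
    (hasSum_ringChoose_mul_pow_one_sub_rpow r ((abs_of_nonneg h0).trans_lt h1))
  have hgeom : HasSum (fun k ↦ y ^ M * y ^ k) (y ^ M / (1 - y)) := by
    simpa only [div_eq_mul_inv] using (hasSum_geometric_of_lt_one h0 h1).mul_left (y ^ M)
  have heval : (oneSubRpowTaylor r M).eval y =
      ∑ k ∈ range M, Ring.choose r k * (-1) ^ k * y ^ k := by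
    simp only [oneSubRpowTaylor, eval_finsetSum, eval_mul, eval_C, eval_pow, eval_X]
  rw [heval, ← htail.tsum_eq, ← Real.norm_eq_abs]
  refine tsum_of_norm_bounded hgeom fun k ↦ ?_
  rw [norm_mul, norm_mul, norm_pow, norm_neg, norm_one, one_pow, mul_one, Real.norm_eq_abs,
    Real.norm_of_nonneg (pow_nonneg h0 _), ← pow_add, add_comm M]
  exact mul_le_of_le_one_left (pow_nonneg h0 _) (abs_ringChoose_le_one hr _)

theorem pow_div_one_sub_le {R : Type*} [Field R] [LinearOrder R] [IsStrictOrderedRing R] (M : ℕ)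
    {y : R} (h0 : 0 ≤ y) (h1 : y < 1) : y ^ M / (1 - y) ≤ 1 / ((M + 1) * (1 - y) ^ 2) := by
  have hy : 0 < 1 - y := sub_pos.2 h1
  have hbernstein := choose_mul_pow_mul_pow_le_add_pow 1 M hy.le h0
  rw [Nat.choose_one_right, sub_add_cancel, one_pow, pow_one] at hbernstein
  push_cast at hbernstein
  rw [div_le_div_iff₀ hy (by positivity)]
  calc y ^ M * ((M + 1) * (1 - y) ^ 2) = (M + 1) * ((1 - y) * y ^ M) * (1 - y) := by ring
    _ ≤ 1 * (1 - y) := by gcongr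

theorem abs_one_sub_rpow_sub_eval_oneSubRpowTaylor_two_pow_le {r : ℝ} (hr : |r| ≤ 1) {k : ℕ}
    {y : ℝ} (h0 : 0 ≤ y) (hy : y ≤ 1 - (1 / 2) ^ k) :
    |(1 - y) ^ r - (oneSubRpowTaylor r (2 ^ (3 * k + 1))).eval y| ≤ (1 / 2) ^ (k + 1) := by
  have hgap : (1 / 2 : ℝ) ^ k ≤ 1 - y := le_sub_comm.1 hy
  have h1 : y < 1 := sub_pos.1 (lt_of_lt_of_le (by positivity) hgap)
  calc |(1 - y) ^ r - (oneSubRpowTaylor r (2 ^ (3 * k + 1))).eval y|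
      ≤ y ^ (2 ^ (3 * k + 1)) / (1 - y) :=
        abs_one_sub_rpow_sub_eval_oneSubRpowTaylor_le hr _ h0 h1
    _ ≤ 1 / (((2 ^ (3 * k + 1) : ℕ) + 1) * (1 - y) ^ 2) := pow_div_one_sub_le _ h0 h1
    _ ≤ 1 / (2 ^ (3 * k + 1) * ((1 / 2) ^ k) ^ 2) := by
        push_cast
        gcongr
        exact le_add_of_nonneg_right zero_le_one
    _ = (1 / 2) ^ (k + 1) := by
        rw [show 3 * k + 1 = k * 2 + (k + 1) by ring, pow_add]
        simp only [one_div_pow]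
        field_simp
        ring

theorem exists_sparse_approx_one_sub_rpow {r : ℝ} (hr : |r| ≤ 1) (k : ℕ) :
    ∃ q : ℝ[X], #q.support ≤ 24 * (k + 1) ^ 2 ∧ q.natDegree ≤ 2 ^ (4 * (k + 1)) ∧
      (∀ l, |q.coeff l| ≤ 2 ^ (12 * (k + 1) ^ 2)) ∧
      ∀ y : ℝ, 0 ≤ y → y ≤ 1 - (1 / 2) ^ k → |(1 - y) ^ r - q.eval y| ≤ (1 / 2) ^ k := by
  obtain ⟨q, hcard, hdeg, hcoeff, happrox⟩ := exists_sparse_approx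
    (natDegree_oneSubRpowTaylor_lt r (Nat.two_pow_pos (3 * k + 1)))
    (abs_coeff_oneSubRpowTaylor_le_one hr _) (4 * k + 2)
  refine ⟨q, hcard.trans (by nlinarith), ?_, fun l ↦ (hcoeff l).trans ?_, fun y h0 hy ↦ ?_⟩
  · have hhead : 2 ^ (3 * k + 1) ≤ 2 ^ (4 * k + 3) := Nat.pow_le_pow_right two_pos (by lia)
    have htail : 4 * k + 3 < 2 ^ (4 * k + 3) := Nat.lt_two_pow_self
    have hdouble : 2 ^ (4 * (k + 1)) = 2 * 2 ^ (4 * k + 3) := by ring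
    lia
  · calc (2 : ℝ) ^ (3 * k + 1) * (2 * 2 ^ (3 * k + 1)) ^ (4 * k + 2)
        = 2 ^ (3 * k + 1 + (3 * k + 2) * (4 * k + 2)) := by
          rw [← pow_succ', ← pow_mul, ← pow_add]
      _ ≤ 2 ^ (12 * (k + 1) ^ 2) := pow_le_pow_right₀ one_le_two (by nlinarith)
  · have htruncate := abs_one_sub_rpow_sub_eval_oneSubRpowTaylor_two_pow_le hr h0 hy
    have hy1 : y ≤ 1 := hy.trans (sub_le_self _ (by positivity))
    have hcompress := happrox y h0 hy1
    calc |(1 - y) ^ r - q.eval y|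
        ≤ (1 / 2) ^ (k + 1) + 2 ^ (3 * k + 1) * (1 / 2) ^ (4 * k + 2) :=
          (abs_sub_le _ _ _).trans (add_le_add htruncate hcompress)
      _ = (1 / 2) ^ k := by
          rw [show 4 * k + 2 = 3 * k + 1 + (k + 1) by ring, pow_add _ (3 * k + 1), ← mul_assoc,
            ← mul_pow]
          norm_num
          ring

end BinomialSeries

namespace AttnOnly

open scoped Matrix Matrix.Norms.Frobenius

theorem exists_mem_transformerClass_of_attnLayer {d n dOut H : ℕ} {lam RKQ RV : ℝ}
    (hlam : 0 < lam) (L : AttnLayer H (d + n + 1) dOut) (hOut : dOut ≤ d + n + 1)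
    (hdim : ∀ h, (L h).dim ≤ d + n + 1) (hKQ : ∀ h, ‖(L h).WKQ‖ ≤ RKQ)
    (hV : ∀ h, ‖(L h).WV‖ ≤ RV) (hKQ₀ : ∃ h, (L h).WKQ ≠ 0) (hV₀ : ∃ h, (L h).WV ≠ 0) :
    ∃ CKQ CV : ℝ, CKQ ≤ RKQ ∧ CV ≤ RV ∧
      (fun X ↦ truncate (attn lam L (preprocess X))) ∈
        TransformerClass d n dOut H (d + n + 1) 1 lam CKQ CV := by
  obtain ⟨i, hi⟩ := hKQ₀
  obtain ⟨j, hj⟩ := hV₀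
  have : Nonempty (Fin H) := ⟨i⟩
  obtain ⟨iMax, hiMax⟩ := Finite.exists_max fun h ↦ ‖(L h).WKQ‖
  obtain ⟨jMax, hjMax⟩ := Finite.exists_max fun h ↦ ‖(L h).WV‖
  refine ⟨‖(L iMax).WKQ‖, ‖(L jMax).WV‖, hKQ iMax, hV jMax, hlam,
    (norm_pos_iff.2 hi).trans_le (hiMax i), (norm_pos_iff.2 hj).trans_le (hjMax j),
    .cons L (.nil dOut), ⟨.inl (.inl rfl), ?_⟩, ⟨.inl ⟨iMax, rfl⟩, ?_⟩, ⟨.inl ⟨jMax, rfl⟩, ?_⟩,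
    fun X ↦ rfl⟩
  · rintro _ ((rfl | ⟨h, rfl⟩) | rfl)
    exacts [le_rfl, hdim h, hOut]
  · rintro _ (⟨h, rfl⟩ | hnil)
    exacts [hiMax h, hnil.elim]
  · rintro _ (⟨h, rfl⟩ | hnil)
    exacts [hjMax h, hnil.elim]

/-- The head computing the sigmoid unit `t ↦ v * sigmoid (lam * (a * t + b))` of a scalar input.
The value and key matrices only read the positional encoding, so the attention logits of the
first token are `a * t + b` and `0`. -/
def sigmoidHead (v a b : ℝ) : AttnHead (1 + 1 + 1) 1 where
  dim := 1
  WK := (!![0, 1, 0] : Matrix (Fin 1) (Fin 3) ℝ)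
  WQ := (!![a, b, 0] : Matrix (Fin 1) (Fin 3) ℝ)
  WV := (!![0, v, 0] : Matrix (Fin 1) (Fin 3) ℝ)

theorem preprocess_scalar (t : ℝ) :
    preprocess (Matrix.of fun (_ : Fin 1) (_ : Fin 1) ↦ t) =
      (!![t, 0; 1, 0; 0, 1] : Matrix (Fin 3) (Fin 2) ℝ) := by
  ext i j
  fin_cases i <;> fin_cases j <;> rfl

theorem attn_sigmoidHead_preprocess (lam : ℝ) {H : ℕ} (v a b : Fin H → ℝ) (t : ℝ) :
    attn lam (fun h ↦ sigmoidHead (v h) (a h) (b h))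
      (preprocess (Matrix.of fun (_ : Fin 1) (_ : Fin 1) ↦ t)) 0 0 =
      ∑ h, v h * Real.sigmoid (lam * (a h * t + b h)) := by
  rw [preprocess_scalar, attn, Matrix.sum_apply]
  refine sum_congr rfl fun h _ ↦ ?_
  have hsoftmax : ∀ u : ℝ, Real.exp u / (Real.exp u + 1) = Real.sigmoid u := fun u ↦ by
    rw [Real.sigmoid_def, Real.exp_neg]
    field_simp
  change ((!![0, v h, 0] : Matrix (Fin 1) (Fin 3) ℝ) * (!![t, 0; 1, 0; 0, 1] : Matrix _ (Fin 2) ℝ) *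
    colSoftmax lam (((!![0, 1, 0] : Matrix (Fin 1) (Fin 3) ℝ) * !![t, 0; 1, 0; 0, 1])ᵀ *
      ((!![a h, b h, 0] : Matrix (Fin 1) (Fin 3) ℝ) * !![t, 0; 1, 0; 0, 1]))) 0 0 = _
  simp [colSoftmax, softmax, Matrix.mul_apply, Matrix.transpose_apply, Fin.sum_univ_succ, hsoftmax]

theorem norm_WV_sigmoidHead (v a b : ℝ) : ‖(sigmoidHead v a b).WV‖ = |v| := by
  change ‖(!![0, v, 0] : Matrix (Fin 1) (Fin 3) ℝ)‖ = |v|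
  rw [Matrix.frobenius_norm_def, ← Real.sqrt_eq_rpow]
  simp [Fin.sum_univ_succ, Real.sqrt_sq_eq_abs]

theorem norm_WKQ_sigmoidHead (v a b : ℝ) : ‖(sigmoidHead v a b).WKQ‖ = √(a ^ 2 + b ^ 2) := by
  change ‖(!![0, 1, 0] : Matrix (Fin 1) (Fin 3) ℝ)ᵀ *
    (!![a, b, 0] : Matrix (Fin 1) (Fin 3) ℝ)‖ = _
  rw [Matrix.frobenius_norm_def, ← Real.sqrt_eq_rpow]
  simp [Fin.sum_univ_succ, Matrix.mul_apply]

theorem exists_mem_transformerClass_eq_sum_sigmoid {H : ℕ} {lam RKQ RV : ℝ} (hlam : 0 < lam)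
    (v a b : Fin H → ℝ) (hKQ : ∀ h, √(a h ^ 2 + b h ^ 2) ≤ RKQ) (hV : ∀ h, |v h| ≤ RV)
    (hb : ∃ h, b h ≠ 0) (hv : ∃ h, v h ≠ 0) :
    ∃ CKQ CV : ℝ, CKQ ≤ RKQ ∧ CV ≤ RV ∧ ∃ f ∈ TransformerClass 1 1 1 H 3 1 lam CKQ CV,
      ∀ t : ℝ, f (Matrix.of fun _ _ ↦ t) 0 0 =
        ∑ h, v h * Real.sigmoid (lam * (a h * t + b h)) := by
  obtain ⟨i, hi⟩ := hb
  obtain ⟨j, hj⟩ := hv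
  have hWKQ : (sigmoidHead (v i) (a i) (b i)).WKQ ≠ 0 := by
    rw [← norm_pos_iff, norm_WKQ_sigmoidHead]
    positivity
  have hWV : (sigmoidHead (v j) (a j) (b j)).WV ≠ 0 := by
    rwa [← norm_pos_iff, norm_WV_sigmoidHead, abs_pos]
  obtain ⟨CKQ, CV, hCKQ, hCV, hf⟩ := exists_mem_transformerClass_of_attnLayer
    (d := 1) (n := 1) hlam (fun h ↦ sigmoidHead (v h) (a h) (b h)) (by simp)
    (fun _ ↦ Nat.le_add_left 1 2) (fun h ↦ (norm_WKQ_sigmoidHead _ _ _).trans_le (hKQ h))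
    (fun h ↦ (norm_WV_sigmoidHead _ _ _).trans_le (hV h)) ⟨i, hWKQ⟩ ⟨j, hWV⟩
  exact ⟨CKQ, CV, hCKQ, hCV, _, hf, attn_sigmoidHead_preprocess lam v a b⟩

theorem abs_mul_sigmoid_sub_exp_neg_le {s x : ℝ} (hs : 0 < s) (hx : 0 ≤ x) :
    |s * Real.sigmoid (-(x + Real.log s)) - Real.exp (-x)| ≤ 1 / s := by
  have hu : 1 ≤ Real.exp x := Real.one_le_exp hx
  have herror : s * Real.sigmoid (-(x + Real.log s)) - Real.exp (-x) =
      -(1 / (Real.exp x * (1 + Real.exp x * s))) := by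
    rw [Real.sigmoid_def, neg_neg, Real.exp_add, Real.exp_log hs, Real.exp_neg]
    field_simp
    ring
  rw [herror, abs_neg, abs_of_nonneg (by positivity)]
  refine one_div_le_one_div_of_le hs ?_
  calc s ≤ 1 + Real.exp x * s := by nlinarith
    _ ≤ Real.exp x * (1 + Real.exp x * s) := le_mul_of_one_le_left (by positivity) hu

theorem exists_mem_transformerClass_eq_sum_support {p : ℝ[X]} (hp : p ≠ 0) {D s : ℝ}
    (hs : 1 < s) (hcoeff : ∀ k, |p.coeff k| ≤ D) (hdeg : p.natDegree ≤ s) :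
    ∃ CKQ CV : ℝ, CKQ ≤ 2 ∧ CV ≤ D * s ∧
      ∃ f ∈ TransformerClass 1 1 1 #p.support 3 1 s CKQ CV, ∀ t : ℝ,
        f (Matrix.of fun _ _ ↦ t) 0 0 =
          ∑ k ∈ p.support, p.coeff k * (s * Real.sigmoid (-(k * t + Real.log s))) := by
  have hs0 : 0 < s := zero_lt_one.trans hs
  have hlog : 0 < Real.log s := Real.log_pos hs
  let e : Fin #p.support ≃ p.support := p.support.equivFin.symm
  let h₀ : Fin #p.support := ⟨0, card_pos.2 (nonempty_support_iff.2 hp)⟩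
  have hKQ (h : Fin #p.support) : √((-((e h : ℕ) / s)) ^ 2 + (-(Real.log s / s)) ^ 2) ≤ 2 := by
    have hexp : ((e h : ℕ) : ℝ) / s ≤ 1 :=
      div_le_one_of_le₀ ((Nat.cast_le.2 (le_natDegree_of_mem_supp _ (e h).2)).trans hdeg) hs0.le
    have hbias : Real.log s / s ≤ 1 := div_le_one_of_le₀ (Real.log_le_self hs0.le) hs0.le
    rw [neg_sq, neg_sq, Real.sqrt_le_left zero_le_two]
    linarith [pow_le_one₀ (n := 2) (by positivity) hexp, pow_le_one₀ (n := 2) (by positivity) hbias]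
  have hV (h : Fin #p.support) : |p.coeff (e h) * s| ≤ D * s := by
    rw [abs_mul, abs_of_pos hs0]
    exact mul_le_mul_of_nonneg_right (hcoeff _) hs0.le
  obtain ⟨CKQ, CV, hCKQ, hCV, f, hf, hft⟩ := exists_mem_transformerClass_eq_sum_sigmoid hs0
    (fun h ↦ p.coeff (e h) * s) (fun h ↦ -((e h : ℕ) / s)) (fun _ ↦ -(Real.log s / s)) hKQ hV
    ⟨h₀, neg_ne_zero.2 (div_ne_zero hlog.ne' hs0.ne')⟩
    ⟨h₀, mul_ne_zero (mem_support_iff.1 (e h₀).2) hs0.ne'⟩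
  refine ⟨CKQ, CV, hCKQ, hCV, f, hf, fun t ↦ ?_⟩
  rw [hft, ← sum_coe_sort p.support, ← e.sum_comp]
  refine sum_congr rfl fun h _ ↦ ?_
  rw [mul_assoc]
  congr 3
  field_simp
  ring

theorem abs_sum_mul_sigmoid_sub_eval_exp_neg_le {p : ℝ[X]} {D s t : ℝ} (hs : 0 < s)
    (hcoeff : ∀ k, |p.coeff k| ≤ D) (ht : 0 ≤ t) :
    |∑ k ∈ p.support, p.coeff k * (s * Real.sigmoid (-(k * t + Real.log s))) -
      p.eval (Real.exp (-t))| ≤ #p.support * (D * (1 / s)) := by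
  rw [eval_eq_sum, sum_def, ← sum_sub_distrib, ← nsmul_eq_mul]
  refine (abs_sum_le_sum_abs _ _).trans (sum_le_card_nsmul _ _ _ fun k _ ↦ ?_)
  rw [← mul_sub, abs_mul, ← Real.exp_nat_mul, mul_neg]
  exact mul_le_mul (hcoeff k) (abs_mul_sigmoid_sub_exp_neg_le hs (by positivity)) (abs_nonneg _)
    ((abs_nonneg _).trans (hcoeff k))

theorem natCast_mul_two_pow_mul_one_div_two_pow_le {H k : ℕ} (hH : H ≤ 24 * (k + 1) ^ 2) :
    (H : ℝ) * (2 ^ (12 * (k + 1) ^ 2) * (1 / 2 ^ (40 * (k + 1) ^ 2))) ≤ (1 / 2) ^ k := by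
  have hH' : (H : ℝ) ≤ 2 ^ (24 * (k + 1) ^ 2) := mod_cast hH.trans Nat.lt_two_pow_self.le
  calc (H : ℝ) * (2 ^ (12 * (k + 1) ^ 2) * (1 / 2 ^ (40 * (k + 1) ^ 2)))
      ≤ 2 ^ (24 * (k + 1) ^ 2) * (2 ^ (12 * (k + 1) ^ 2) * (1 / 2 ^ (40 * (k + 1) ^ 2))) := by
        gcongr
    _ = (1 / 2) ^ (4 * (k + 1) ^ 2) := by
        rw [show 40 * (k + 1) ^ 2 =
          24 * (k + 1) ^ 2 + (12 * (k + 1) ^ 2 + 4 * (k + 1) ^ 2) by ring, pow_add, pow_add,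
          one_div_pow]
        field_simp
    _ ≤ (1 / 2) ^ k := pow_le_pow_of_le_one (by norm_num) (by norm_num) (by nlinarith)

theorem exists_transformer_approx_one_sub_exp_neg_rpow {r : ℝ} (hr : |r| ≤ 1) {k : ℕ}
    (hk : 1 ≤ k) :
    ∃ (H : ℕ) (CKQ CV : ℝ), H ≤ 24 * (k + 1) ^ 2 ∧ CKQ ≤ 2 ∧ CV ≤ 2 ^ (52 * (k + 1) ^ 2) ∧
      ∃ f ∈ TransformerClass 1 1 1 H 3 1 (2 ^ (40 * (k + 1) ^ 2)) CKQ CV,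
        ∀ t : ℝ, Real.exp (-t) ≤ 1 - (1 / 2) ^ k →
          |f (Matrix.of fun _ _ ↦ t) 0 0 - (1 - Real.exp (-t)) ^ r| ≤ 2 * (1 / 2) ^ k := by
  obtain ⟨q, hcard, hdeg, hcoeff, hq⟩ := exists_sparse_approx_one_sub_rpow hr k
  have hhalf : (1 / 2 : ℝ) ^ k ≤ 1 / 2 :=
    pow_le_of_le_one (by norm_num) (by norm_num) (Nat.ne_of_gt hk)
  have hq0 : q ≠ 0 := by
    rintro rfl
    have hzero := hq 0 le_rfl (by linarith)
    norm_num at hzero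
    linarith
  have hlam : (1 : ℝ) < 2 ^ (40 * (k + 1) ^ 2) := one_lt_pow₀ one_lt_two (by positivity)
  have hdeg' : q.natDegree ≤ (2 : ℝ) ^ (40 * (k + 1) ^ 2) := mod_cast
    hdeg.trans (Nat.pow_le_pow_right two_pos (by nlinarith))
  obtain ⟨CKQ, CV, hCKQ, hCV, f, hf, hft⟩ :=
    exists_mem_transformerClass_eq_sum_support hq0 hlam hcoeff hdeg'
  refine ⟨_, CKQ, CV, hcard, hCKQ, hCV.trans_eq (by rw [← pow_add]; ring), f, hf, fun t ht ↦ ?_⟩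
  have ht0 : 0 ≤ t := by
    have : Real.exp (-t) ≤ 1 := ht.trans (sub_le_self _ (by positivity))
    simpa using this
  have hheads := (abs_sum_mul_sigmoid_sub_eval_exp_neg_le (by positivity) hcoeff ht0).trans
    (natCast_mul_two_pow_mul_one_div_two_pow_le hcard)
  rw [← hft] at hheads
  calc |f (Matrix.of fun _ _ ↦ t) 0 0 - (1 - Real.exp (-t)) ^ r|
      ≤ |f (Matrix.of fun _ _ ↦ t) 0 0 - q.eval (Real.exp (-t))| +
        |q.eval (Real.exp (-t)) - (1 - Real.exp (-t)) ^ r| := abs_sub_le _ _ _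
    _ ≤ (1 / 2) ^ k + (1 / 2) ^ k := by
        rw [abs_sub_comm (q.eval _)]
        exact add_le_add hheads (hq _ (Real.exp_pos _).le ht)
    _ = 2 * (1 / 2) ^ k := (two_mul _).symm

end AttnOnly

section Rates

theorem one_half_le_log_one_div {ε : ℝ} (h0 : 0 < ε) (h1 : ε ≤ 1 / 2) :
    1 / 2 ≤ Real.log (1 / ε) := by
  have : Real.log 2 ≤ Real.log (1 / ε) :=
    Real.log_le_log two_pos ((le_one_div two_pos h0).2 h1)
  linarith [Real.log_two_gt_d9]

theorem exp_neg_le_one_sub_half {ε : ℝ} (h0 : 0 ≤ ε) (h1 : ε ≤ 1) :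
    Real.exp (-ε) ≤ 1 - ε / 2 := by
  rw [Real.exp_neg]
  refine inv_le_of_inv_le₀ (by linarith) ?_
  refine le_trans ?_ (Real.add_one_le_exp ε)
  rw [inv_le_iff_one_le_mul₀ (by linarith)]
  nlinarith

theorem two_pow_le_exp (m : ℕ) : (2 : ℝ) ^ m ≤ Real.exp m := by
  rw [← Real.exp_one_pow]
  exact pow_le_pow_left₀ zero_le_two Real.exp_one_gt_two.le m

theorem exists_half_pow_le_half {ε : ℝ} (h0 : 0 < ε) (h1 : ε ≤ 1) :
    ∃ k : ℕ, 1 ≤ k ∧ (1 / 2 : ℝ) ^ k ≤ ε / 2 ∧ (k : ℝ) + 1 ≤ 3 * (1 + Real.log (1 / ε)) := by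
  have hlog2 : 1 / 2 ≤ Real.log 2 := by linarith [Real.log_two_gt_d9]
  have hlog : 0 ≤ Real.log (1 / ε) := Real.log_nonneg (one_le_one_div h0 h1)
  have hlogb : Real.logb 2 (1 / ε) ≤ 2 * Real.log (1 / ε) := by
    rw [Real.logb, div_le_iff₀ (by linarith)]
    nlinarith
  have hceil := Nat.ceil_lt_add_one (Real.logb_nonneg one_lt_two (one_le_one_div h0 h1))
  refine ⟨⌈Real.logb 2 (1 / ε)⌉₊ + 1, Nat.le_add_left 1 _, ?_, ?_⟩
  · have hpow : 1 / ε ≤ 2 ^ ⌈Real.logb 2 (1 / ε)⌉₊ := by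
      rw [← Real.rpow_natCast, ← Real.logb_le_iff_le_rpow one_lt_two (by positivity)]
      exact Nat.le_ceil _
    rw [pow_succ, one_div_pow, ← div_eq_mul_one_div]
    gcongr
    exact (one_div_le h0 (by positivity)).1 hpow
  · push_cast
    linarith

end Rates

theorem mainTheorem9_general :
    ∃ C : ℝ, 0 < C ∧ ∀ r : ℝ, |r| ≤ 1 → ∀ ε : ℝ, 0 < ε → ε < 1 →
      ∃ (H : ℕ) (lam CKQ CV : ℝ), ∃ f ∈ AttnOnly.TransformerClass 1 1 1 H 3 1 lam CKQ CV,
        (∀ t : ℝ, ε ≤ t →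
          |f (Matrix.of fun _ _ ↦ t) 0 0 - (1 - Real.exp (-t)) ^ r| ≤ ε) ∧
        (H : ℝ) ≤ C * (1 + Real.log (1 / ε)) ^ 2 ∧ CKQ ≤ 2 ∧
        CV ≤ Real.exp (C * (1 + Real.log (1 / ε)) ^ 2) ∧
        lam ≤ Real.exp (C * (1 + Real.log (1 / ε)) ^ 2) := by
  refine ⟨52 * 9, by norm_num, fun r hr ε hε hε1 ↦ ?_⟩
  obtain ⟨k, hk, hhalf, hrate⟩ := exists_half_pow_le_half hε hε1.le
  obtain ⟨H, CKQ, CV, hH, hCKQ, hCV, f, hf, hft⟩ :=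
    AttnOnly.exists_transformer_approx_one_sub_exp_neg_rpow hr hk
  have hsq : ((k : ℝ) + 1) ^ 2 ≤ 9 * (1 + Real.log (1 / ε)) ^ 2 :=
    (pow_le_pow_left₀ (by positivity) hrate 2).trans_eq (by ring)
  have htwo_pow (a : ℕ) (ha : a ≤ 52) :
      (2 : ℝ) ^ (a * (k + 1) ^ 2) ≤ Real.exp (52 * 9 * (1 + Real.log (1 / ε)) ^ 2) := by
    have hcast : (a : ℝ) ≤ 52 := mod_cast ha
    refine (two_pow_le_exp _).trans (Real.exp_le_exp.2 ?_)
    push_cast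
    nlinarith
  refine ⟨H, _, CKQ, CV, f, hf, fun t ht ↦ ?_, ?_, hCKQ, hCV.trans (htwo_pow 52 le_rfl),
    htwo_pow 40 (by norm_num)⟩
  · have hexp : Real.exp (-t) ≤ 1 - (1 / 2) ^ k :=
      (Real.exp_le_exp.2 (neg_le_neg ht)).trans
        ((exp_neg_le_one_sub_half hε.le hε1.le).trans (sub_le_sub_left hhalf 1))
    linarith [hft t hexp]
  · have hH' : (H : ℝ) ≤ 24 * ((k : ℝ) + 1) ^ 2 := mod_cast hH
    nlinarith

section Comparison

-- Below `36 = 9 * 4` comes from `(1 + L) ^ 2 ≤ 9 * L ^ 2` and `L ^ 2 ≤ 4 * L ^ 4`, while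
-- `24 = 3 / (1 / 2) ^ 3` absorbs the width `3`.
variable {C L X : ℝ}

theorem one_add_sq_le_nine_mul_sq (hL : 1 / 2 ≤ L) : (1 + L) ^ 2 ≤ 9 * L ^ 2 := by
  nlinarith

theorem one_le_mul_sq (hC : 0 ≤ C) (hL : 1 / 2 ≤ L) : 1 ≤ (36 * C + 24) * L ^ 2 := by
  nlinarith [pow_le_pow_left₀ (by norm_num) hL 2, mul_nonneg hC (sq_nonneg L)]

theorem three_le_mul_pow_three (hC : 0 ≤ C) (hL : 1 / 2 ≤ L) :
    3 ≤ (36 * C + 24) * L ^ 3 := by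
  have hL3 := pow_le_pow_left₀ (by norm_num) hL 3
  have hCL : 0 ≤ C * L ^ 3 := mul_nonneg hC (by positivity)
  linarith

theorem mul_one_add_sq_le_mul_pow_three (hC : 0 ≤ C) (hL : 1 / 2 ≤ L) :
    C * (1 + L) ^ 2 ≤ (36 * C + 24) * L ^ 3 := by
  have hL0 : 0 ≤ L := by linarith
  calc C * (1 + L) ^ 2 ≤ C * (18 * L ^ 3) := by
        gcongr
        nlinarith [one_add_sq_le_nine_mul_sq hL]
    _ ≤ (36 * C + 24) * L ^ 3 := by
        nlinarith [pow_nonneg hL0 3, mul_nonneg hC (pow_nonneg hL0 3)]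

theorem two_le_mul_sqrt_sq_mul (hC : 0 ≤ C) (hL : 1 / 2 ≤ L) (hX : 0 ≤ X) :
    2 ≤ (36 * C + 24) * √(L ^ 2 * (L ^ 2 + X)) := by
  have hsqrt : L ^ 2 ≤ √(L ^ 2 * (L ^ 2 + X)) :=
    Real.le_sqrt_of_sq_le (by nlinarith [mul_nonneg (sq_nonneg L) hX])
  calc 2 ≤ (36 * C + 24) * L ^ 2 := by
        nlinarith [pow_le_pow_left₀ (by norm_num) hL 2, mul_nonneg hC (sq_nonneg L)]
    _ ≤ (36 * C + 24) * √(L ^ 2 * (L ^ 2 + X)) := by gcongr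

theorem exp_mul_one_add_sq_le_exp_mul_sqrt (hC : 0 ≤ C) (hL : 1 / 2 ≤ L) :
    Real.exp (C * (1 + L) ^ 2) ≤
      Real.exp ((36 * C + 24) * L ^ 2) * ((36 * C + 24) * √(L ^ 3)) := by
  have hexp : C * (1 + L) ^ 2 ≤ (36 * C + 24) * L ^ 2 := by
    nlinarith [mul_le_mul_of_nonneg_left (one_add_sq_le_nine_mul_sq hL) hC,
      mul_nonneg hC (sq_nonneg L)]
  have hsqrt : 1 / 4 ≤ √(L ^ 3) :=
    Real.le_sqrt_of_sq_le (by linarith [pow_le_pow_left₀ (by norm_num) hL 3])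
  refine (Real.exp_le_exp.2 hexp).trans (le_mul_of_one_le_right (Real.exp_pos _).le ?_)
  nlinarith

theorem exp_mul_one_add_sq_le_exp_mul_one_add (hC : 0 ≤ C) (hL : 1 / 2 ≤ L) (hX : 0 ≤ X) :
    Real.exp (C * (1 + L) ^ 2) ≤
      Real.exp ((36 * C + 24) * L ^ 4) * ((36 * C + 24) * (1 + X)) := by
  have hL2 : L ^ 2 ≤ 4 * L ^ 4 := by nlinarith [pow_le_pow_left₀ (by norm_num) hL 2]
  have hexp : C * (1 + L) ^ 2 ≤ (36 * C + 24) * L ^ 4 :=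
    calc C * (1 + L) ^ 2 ≤ C * (36 * L ^ 4) := by
          gcongr
          linarith [one_add_sq_le_nine_mul_sq hL]
      _ ≤ (36 * C + 24) * L ^ 4 := by nlinarith [sq_nonneg (L ^ 2)]
  refine (Real.exp_le_exp.2 hexp).trans (le_mul_of_one_le_right (Real.exp_pos _).le ?_)
  nlinarith

end Comparison

theorem mainTheorem9 :
    ∃ (C : ℝ) (p : Polynomial ℝ), 0 < C ∧
      ∀ ε : ℝ, 0 < ε → ε < 1 → ∀ CX : ℝ, ε < CX →
        ∃ (H W K : ℕ) (lam CKQ CV : ℝ),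
        ∃ f ∈ AttnOnly.TransformerClass 1 1 1 H W K lam CKQ CV,
          (∀ t : ℝ, ε ≤ t → t ≤ CX →
            |f (Matrix.of fun _ _ => t) 0 0 - Real.sqrt (1 - Real.exp (-t))| ≤ ε) ∧
          (ε ≤ 1 / 2 → 1 ≤ CX →
            (H : ℝ) ≤ C * Real.log (1 / ε) ^ 3 ∧
            (W : ℝ) ≤ C * Real.log (1 / ε) ^ 3 ∧
            (K : ℝ) ≤ C * Real.log (1 / ε) ^ 2 ∧
            CV ≤ Real.exp (C * Real.log (1 / ε) ^ 2) *
              (C * Real.sqrt (Real.log (1 / ε) ^ 3)) ∧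
            CKQ ≤ C * Real.sqrt
              (Real.log (1 / ε) ^ 2 * (Real.log (1 / ε) ^ 2 + Real.log CX)) ∧
            lam ≤ Real.exp (C * Real.log (1 / ε) ^ 4) *
              (C * (Real.log (1 / ε) ^ (p.eval (Real.log (1 / ε))) * (1 + Real.log CX)))) := by
  obtain ⟨C, hC, happrox⟩ := mainTheorem9_general
  refine ⟨36 * C + 24, 0, by positivity, fun ε hε hε1 CX _ ↦ ?_⟩
  obtain ⟨H, lam, CKQ, CV, f, hf, hft, hH, hCKQ, hCV, hlam⟩ :=
    happrox (1 / 2) (by norm_num) ε hε hε1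
  refine ⟨H, 3, 1, lam, CKQ, CV, f, hf, fun t ht _ ↦ ?_, fun hε2 hCX ↦ ?_⟩
  · rw [Real.sqrt_eq_rpow]
    exact hft t ht
  have hL := one_half_le_log_one_div hε hε2
  have hX : 0 ≤ Real.log CX := Real.log_nonneg hCX
  rw [Polynomial.eval_zero, Real.rpow_zero, one_mul, Nat.cast_one]
  exact ⟨hH.trans (mul_one_add_sq_le_mul_pow_three hC.le hL), three_le_mul_pow_three hC.le hL,
    one_le_mul_sq hC.le hL, hCV.trans (exp_mul_one_add_sq_le_exp_mul_sqrt hC.le hL),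
    hCKQ.trans (two_le_mul_sqrt_sq_mul hC.le hL hX),
    hlam.trans (exp_mul_one_add_sq_le_exp_mul_one_add hC.le hL hX)⟩
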